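/- Let $M$ be a monoid. An atom is an element $a\neq 1$ such that $a=bc$ implies $b=1$ or $c=1$; $\|a\|$ denotes the supremum of the lengths of all expressions of $a$ as a product of atoms. $M$ is atomic if it is generated by its atoms and $\|a\|<\infty$ for all $a\in M$. Write $a\le_L b$ if $ac=b$ for some $c\in M$, and $a\le_R b$ if $ca=b$ for some $c\in M$. A Garside monoid is a finitely generated, left and right cancellative atomic monoid $M$ such that $(M,\le_L)$ and $(M,\le_R)$ are lattices and which has a Garside element, i.e. an element $\Delta$ such that, for $a\in M$, $a\le_L\Delta$ if and only if $a\le_R\Delta$, and such that $\{a\in M: a\le_L\Delta\}$ generates $M$. Let $G$ be a Garside group, that is, the group of fractions of a Garside monoid $G^+\subseteq G$, with a Garside element $\Delta$ of $G^+$, and let $N=\|\Delta\|$. For $g,h\in G$ write $g\le_L h$ if $gc=h$ for some $c\in G^+$, and put $$\inf(g)=\max\{r\in\mathbb Z:\Delta^r\le_L g\},\qquad \sup(g)=\min\{s\in\mathbb Z: g\le_L\Delta^s\}$$ (for the trivial group, where these do not exist, $\inf=\sup=0$ by convention). Let $[g]=\{x^{-1}gx: x\in G\}$ be the conjugacy class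 of $g$, and $$\inf{}_s(g)=\max\{\inf(h):h\in[g]\},\qquad \sup{}_s(g)=\min\{\sup(h):h\in[g]\},$$ $$[g]^S=\{h\in[g]:\inf(h)=\inf{}_s(g),\ \sup(h)=\sup{}_s(g)\},\qquad [g]^{\mathrm{St}}=\{h\in[g]^S: h^k\in[g^k]^S\text{ for all } k\ge 1\}.$$ Theorem. For every $g\in G$: (i) If $h\in[g]$ satisfies $\inf(h^n)=\inf_s(g^n)$ for all $1\le n\le N$, then $\inf(h^n)=\inf_s(g^n)$ for all $n\ge 1$. (ii) If $h\in[g]$ satisfies $\sup(h^n)=\sup_s(g^n)$ for all $1\le n\le N$, then $\sup(h^n)=\sup_s(g^n)$ for all $n\ge 1$. (iii) $[g]^{\mathrm{St}}=\{h\in[g]^S: h^n\in[g^n]^S\text{ for all }1\le n\le N\}$. -/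

import Mathlib

namespace Garside

section Monoid

variable {M : Type*} [Monoid M]

/-- An atom of a monoid: `a ≠ 1` such that `a = b * c` forces `b = 1` or `c = 1`. -/
def IsMonoidAtom (a : M) : Prop :=
  a ≠ 1 ∧ ∀ b c : M, a = b * c → b = 1 ∨ c = 1

/-- `‖a‖`: the supremum of the lengths of all expressions of `a` as a product of atoms. -/
noncomputable def atomNorm (a : M) : ℕ∞ :=
  ⨆ l ∈ {l : List M | (∀ x ∈ l, IsMonoidAtom x) ∧ l.prod = a}, (l.length : ℕ∞)

variable (M) in
/-- A monoid is atomic if its atoms generate it and `‖a‖ < ∞` for every `a`. -/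
def IsAtomicMonoid : Prop :=
  Submonoid.closure {a : M | IsMonoidAtom a} = ⊤ ∧ ∀ a : M, atomNorm a < ⊤

/-- `a ≤_L b` in a monoid. -/
def DivL (a b : M) : Prop := ∃ c : M, a * c = b

/-- `a ≤_R b` in a monoid. -/
def DivR (a b : M) : Prop := ∃ c : M, c * a = b

end Monoid

/-- Any two elements have a greatest lower bound and a least upper bound for `r`
(used for the divisibility relations, which are partial orders on an atomic monoid). -/
def IsLatticeOrder {α : Type*} (r : α → α → Prop) : Prop :=
  ∀ a b : α,
    (∃ m, r m a ∧ r m b ∧ ∀ d, r d a → r d b → r d m) ∧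
    (∃ j, r a j ∧ r b j ∧ ∀ d, r a d → r b d → r j d)

/-- `M` is a Garside monoid and `Δ` is a Garside element of `M`. -/
structure IsGarsideMonoid (M : Type*) [Monoid M] (Δ : M) : Prop where
  atomic : IsAtomicMonoid M
  fg : Monoid.FG M
  cancel : IsCancelMul M
  latticeL : IsLatticeOrder (DivL : M → M → Prop)
  latticeR : IsLatticeOrder (DivR : M → M → Prop)
  divL_iff_divR : ∀ a : M, DivL a Δ ↔ DivR a Δ
  closure_simple : Submonoid.closure {a : M | DivL a Δ} = ⊤

section Group

variable {G : Type*} [Group G]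

/-- `G` is a Garside group with positive monoid `P` and Garside element `Δ`: `P` is a Garside
monoid with Garside element `Δ`, and `G` is the group of fractions of `P`. -/
structure IsGarsideGroup (P : Submonoid G) (Δ : P) : Prop where
  monoid : IsGarsideMonoid P Δ
  fractions : ∀ g : G, ∃ a ∈ P, ∃ b ∈ P, g = a * b⁻¹

/-- `g ≤_L h` in a Garside group with positive monoid `P`. -/
def LeL (P : Submonoid G) (g h : G) : Prop := ∃ c ∈ P, g * c = h

/-- `inf(g) = max {r ∈ ℤ : Δ ^ r ≤_L g}`. -/
noncomputable def inf (P : Submonoid G) (Δ : P) (g : G) : ℤ :=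
  sSup {r : ℤ | LeL P ((Δ : G) ^ r) g}

/-- `sup(g) = min {s ∈ ℤ : g ≤_L Δ ^ s}`. -/
noncomputable def sup (P : Submonoid G) (Δ : P) (g : G) : ℤ :=
  sInf {s : ℤ | LeL P g ((Δ : G) ^ s)}

/-- The conjugacy class `[g] = {x⁻¹ g x : x ∈ G}`. -/
def conjClass (g : G) : Set G := {h : G | ∃ x : G, h = x⁻¹ * g * x}

/-- `inf_s(g) = max {inf(h) : h ∈ [g]}`. -/
noncomputable def infS (P : Submonoid G) (Δ : P) (g : G) : ℤ :=
  sSup (inf P Δ '' conjClass g)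

/-- `sup_s(g) = min {sup(h) : h ∈ [g]}`. -/
noncomputable def supS (P : Submonoid G) (Δ : P) (g : G) : ℤ :=
  sInf (sup P Δ '' conjClass g)

/-- The super summit set `[g]^S`. -/
def superSummitSet (P : Submonoid G) (Δ : P) (g : G) : Set G :=
  {h ∈ conjClass g | inf P Δ h = infS P Δ g ∧ sup P Δ h = supS P Δ g}

/-- The stable super summit set `[g]^St`. -/
def stableSuperSummitSet (P : Submonoid G) (Δ : P) (g : G) : Set G :=
  {h ∈ superSummitSet P Δ g | ∀ k : ℕ, 1 ≤ k → h ^ k ∈ superSummitSet P Δ (g ^ k)}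

end Group

end Garside

namespace Garside

/-! ### Length in atoms. -/

section Monoid

variable {M : Type*} [Monoid M]

/-! Order `G` by `LeL`: left translations and right multiplication by powers of `Δ` preserve the
order, and `inf_s(g) ≥ r` says that left translation by `g` moves some `x` at least as far as `x Δ ^
r` (`le_infS_iff`). So `inf_s(g ^ n) / n` is a slope.

From a point on which `g ^ n` has slope `r / n`, `exists_chain` builds by meets a `Δ`-periodic chain
on which `g` itself advances at least `r` steps per period of `n`. A period is an interval `[x, x
Δ]`, so it has at most `N` strict jumps; following jumps and applying the pigeonhole principle, some
power `g ^ q` with `q ≤ N` has at least the same slope (`exists_bounded_pow`). Hence the maximal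
slope over all `n` is attained at some `q ≤ N`.

Write `n = q k + s` with `s < q`. Maximality of the slope gives `inf_s(g ^ n) ≤ k inf_s(g ^ q) +
inf_s(g ^ s)`; the hypothesis on `h` at `q` and `s` together with superadditivity of `inf` bounds
`inf(h ^ n)` below by the right-hand side (`inf_pow_eq_infS`). Inversion turns `sup` into `-inf`,
and (iii) combines both. -/

lemma le_atomNorm {l : List M} {a : M} (hl : ∀ x ∈ l, IsMonoidAtom x) (ha : l.prod = a) :
    (l.length : ℕ∞) ≤ atomNorm a :=
  le_iSup₂_of_le (f := fun (l : List M) (_ : l ∈ {l : List M | (∀ x ∈ l, IsMonoidAtom x) ∧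
    l.prod = a}) => (l.length : ℕ∞)) l ⟨hl, ha⟩ le_rfl

lemma IsAtomicMonoid.exists_list (hM : IsAtomicMonoid M) (a : M) :
    ∃ l : List M, (∀ x ∈ l, IsMonoidAtom x) ∧ l.prod = a := by
  have ha : a ∈ Submonoid.closure {a : M | IsMonoidAtom a} := by rw [hM.1]; trivial
  exact Submonoid.exists_list_of_mem_closure ha

/-- Append an atomic expression of `b`, which is nonempty, to any expression of `a`. -/
lemma IsAtomicMonoid.atomNorm_add_one_le (hM : IsAtomicMonoid M) (a : M) {b : M} (hb : b ≠ 1) :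
    atomNorm a + 1 ≤ atomNorm (a * b) := by
  obtain ⟨lb, hlb, hpb⟩ := hM.exists_list b
  have hlen : 1 ≤ lb.length := by
    rcases lb with _ | ⟨x, l⟩
    · exact absurd hpb.symm hb
    · simp
  obtain ⟨n, hn⟩ := ENat.ne_top_iff_exists.mp (hM.2 (a * b)).ne
  have key : ∀ l : List M, (∀ x ∈ l, IsMonoidAtom x) → l.prod = a → l.length + 1 ≤ n := by
    intro l hl hp
    have h := le_atomNorm (l := l ++ lb) (a := a * b)
      (fun x hx => (List.mem_append.mp hx).elim (hl x) (hlb x)) (by simp [hp, hpb])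
    rw [← hn, List.length_append] at h
    have : l.length + lb.length ≤ n := by exact_mod_cast h
    omega
  obtain ⟨la, hla, hpa⟩ := hM.exists_list a
  have hn1 := key la hla hpa
  have : atomNorm a ≤ ((n - 1 : ℕ) : ℕ∞) := by
    refine iSup₂_le fun l hl => ?_
    have := key l hl.1 hl.2
    exact_mod_cast (by omega : l.length ≤ n - 1)
  calc atomNorm a + 1 ≤ ((n - 1 : ℕ) : ℕ∞) + 1 := by gcongr
    _ = atomNorm (a * b) := by rw [← hn]; exact_mod_cast (by omega : n - 1 + 1 = n)

lemma IsAtomicMonoid.eq_one_of_mul_eq_one (hM : IsAtomicMonoid M) {a b : M} (h : a * b = 1) :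
    a = 1 := by
  by_contra ha
  by_cases hb : b = 1
  · exact ha (by simpa [hb] using h)
  have h1 := hM.atomNorm_add_one_le 1 ha
  have h2 := hM.atomNorm_add_one_le a hb
  rw [one_mul] at h1
  rw [h] at h2
  obtain ⟨n, hn⟩ := ENat.ne_top_iff_exists.mp (hM.2 (1 : M)).ne
  obtain ⟨m, hm⟩ := ENat.ne_top_iff_exists.mp (hM.2 a).ne
  rw [← hn, ← hm] at h1 h2
  have h1' : n + 1 ≤ m := by exact_mod_cast h1
  have h2' : m + 1 ≤ n := by exact_mod_cast h2
  omega

end Monoid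

lemma shift_zpow {G : Type*} [Group G] {δ : G} {z : ℤ → G} {n : ℤ}
    (hz : ∀ k, z (k + n) = z k * δ) (k j : ℤ) : z (k + n * j) = z k * δ ^ j := by
  induction j with
  | zero => simp
  | succ j ih => rw [mul_add, mul_one, ← add_assoc, hz, ih, zpow_add, zpow_one, mul_assoc]
  | pred j ih =>
    have h2 := hz (k + n * (-(j : ℤ) - 1))
    rw [show (k + n * (-(j : ℤ) - 1) + n : ℤ) = k + n * -(j : ℤ) by ring, ih] at h2
    rw [zpow_sub, zpow_one, ← mul_assoc, h2, mul_inv_cancel_right]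

/-! ### Slopes of left translations in an ordered group with meets. -/

section OrderedGroup

variable {G : Type*} [Group G] [SemilatticeInf G] [MulLeftMono G] {δ : G}

/-- If `x⁻¹ g ^ n x ≥ δ ^ r`, the meets of the elements `g ^ i x δ ^ c` with `c n + i r ≥ k` form
a chain which `δ` shifts by `n` and `g` shifts by at least `r`. -/
lemma exists_chain (h1 : 1 ≤ δ) (hδ : ∀ (m : ℤ) (a b : G), a ≤ b → a * δ ^ m ≤ b * δ ^ m)
    {g x : G} {n : ℕ} (hn : 1 ≤ n) {r : ℤ} (h : x * δ ^ r ≤ g ^ n * x) :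
    ∃ z : ℤ → G, Monotone z ∧ (∀ k, z (k + n) = z k * δ) ∧ ∀ k, z (k + r) ≤ g * z k := by
  have hn0 : (n : ℤ) ≠ 0 := by omega
  have hne : (Finset.range n).Nonempty := ⟨0, by simp; omega⟩
  -- The ceiling of `(k - i r) / n`, that is, the least `c` with `c n + i r ≥ k`.
  let c : ℕ → ℤ → ℤ := fun i k => -((i * r - k) / n)
  have hc : ∀ i, Monotone (c i) := fun i k l hkl =>
    neg_le_neg (Int.ediv_le_ediv (by omega) (by omega))
  have hcn : ∀ i k, c i (k + n) = c i k + 1 := by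
    intro i k
    have : (i * r - (k + n) : ℤ) = i * r - k + (-1) * n := by ring
    simp only [c, this, Int.add_mul_ediv_right _ _ hn0]
    ring
  have hcr : ∀ i k, c (i + 1) (k + r) = c i k := by
    intro i k
    have : (((i + 1 : ℕ) : ℤ) * r - (k + r) : ℤ) = i * r - k := by push_cast; ring
    simp only [c, this]
  have hc0 : ∀ k, c 0 k = r + c n k := by
    intro k
    have : ((n : ℤ) * r - k : ℤ) = ((0 : ℕ) : ℤ) * r - k + r * n := by push_cast; ring
    simp only [c, this, Int.add_mul_ediv_right _ _ hn0]
    ring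
  let z : ℤ → G := fun k => (Finset.range n).inf' hne fun i => g ^ i * x * δ ^ c i k
  have hz : ∀ k i, i < n → z k ≤ g ^ i * x * δ ^ c i k := fun k i hi =>
    Finset.inf'_le (fun i => g ^ i * x * δ ^ c i k) (Finset.mem_range.mpr hi)
  have hz' : ∀ k a, (∀ i, i < n → a ≤ g ^ i * x * δ ^ c i k) → a ≤ z k := fun k a ha =>
    Finset.le_inf' _ _ fun i hi => ha i (Finset.mem_range.mp hi)
  have hpow : ∀ {m m' : ℤ} (a : G), m ≤ m' → a * δ ^ m ≤ a * δ ^ m' := by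
    intro m m' a hm
    obtain ⟨d, rfl⟩ := Int.le.dest hm
    rw [add_comm, zpow_add]
    refine mul_le_mul_right ?_ a
    simpa using hδ m 1 (δ ^ d) (one_le_pow_of_one_le' h1 d)
  refine ⟨z, fun k l hkl => hz' l _ fun i hi => (hz k i hi).trans (hpow _ (hc i hkl)),
    fun k => le_antisymm ?_ (hz' _ _ fun i hi => ?_), fun k => ?_⟩
  · have : z (k + n) * δ ^ (-1 : ℤ) ≤ z k := hz' _ _ fun i hi => by
      have h2 := hδ (-1) _ _ (hz (k + n) i hi)
      rwa [hcn, mul_assoc (g ^ i * x), ← zpow_add, add_neg_cancel_right] at h2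
    simpa using hδ 1 _ _ this
  · rw [hcn, zpow_add, zpow_one, ← mul_assoc]
    simpa using hδ 1 _ _ (hz k i hi)
  · rw [← inv_mul_le_iff_le_mul]
    refine hz' _ _ fun i hi => ?_
    rw [inv_mul_le_iff_le_mul, ← mul_assoc, ← mul_assoc, ← pow_succ', ← hcr i k]
    rcases Nat.lt_or_ge (i + 1) n with hin | hin
    · exact hz _ _ hin
    -- The index wraps around: the hypothesis on `g ^ n` brings the term back to `i = 0`.
    · obtain rfl : n = i + 1 := by omega
      refine (hz (k + r) 0 (by omega)).trans ?_
      rw [hc0, pow_zero, one_mul, zpow_add, ← mul_assoc]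
      exact hδ _ _ _ h

/-- Along the chain for slope `r n / n`, `g` advances `z 0` by `r` full periods, that is, by `δ ^
r`. -/
lemma exists_le_of_pow (h1 : 1 ≤ δ) (hδ : ∀ (m : ℤ) (a b : G), a ≤ b → a * δ ^ m ≤ b * δ ^ m)
    {g x : G} {n : ℕ} (hn : 1 ≤ n) {r : ℤ} (h : x * δ ^ (r * n) ≤ g ^ n * x) :
    ∃ y, y * δ ^ r ≤ g * y := by
  obtain ⟨z, -, hzn, hz⟩ := exists_chain h1 hδ hn h
  refine ⟨z 0, ?_⟩
  rw [← shift_zpow hzn]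
  simpa [mul_comm] using hz 0

/-- If strict chains in every interval `[x, x δ]` have length at most `N`, then a power of `g` of
exponent at most `N` moves some point by at least the slope `r / n`. -/
lemma exists_bounded_pow (h1 : 1 ≤ δ) (hδ1 : δ ≠ 1)
    (hδ : ∀ (m : ℤ) (a b : G), a ≤ b → a * δ ^ m ≤ b * δ ^ m) {N : ℕ}
    (hN : ∀ x : G, ∃ F : G → ℕ, ∀ a b, x ≤ a → a < b → b ≤ x * δ → F a < F b ∧ F b ≤ N)
    {g x : G} {n : ℕ} (hn : 1 ≤ n) {r : ℤ} (h : x * δ ^ r ≤ g ^ n * x) :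
    ∃ q : ℕ, 1 ≤ q ∧ q ≤ N ∧ ∃ (p : ℤ) (y : G), y * δ ^ p ≤ g ^ q * y ∧ q * r ≤ n * p := by
  obtain ⟨z, hmono, hzn, hzr⟩ := exists_chain h1 hδ hn h
  have hn0 : (n : ℤ) ≠ 0 := by omega
  have hshift := shift_zpow hzn
  -- The last index with the value `z k`, just before a jump. It exists since `z` cannot stay
  -- constant over a whole period when `δ ≠ 1`.
  have hT : ∀ k, ∃ k', k ≤ k' ∧ z k' = z k ∧ z (k' + 1) ≠ z k' := by
    intro k
    by_contra! hcon
    have hconst : ∀ j : ℕ, z (k + j) = z k := by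
      intro j
      induction j with
      | zero => simp
      | succ j ih =>
        have := hcon (k + j) (by omega) ih
        rw [ih] at this
        push_cast
        rwa [← add_assoc]
    have h2 := hconst n
    rw [hzn] at h2
    exact hδ1 (mul_eq_left.mp h2)
  choose T hTle hTeq hTne using hT
  -- An orbit of jumps: advance by `r`, then slide to the next jump without changing the value of
  -- `z`.
  let κ : ℕ → ℤ := fun i => Nat.rec (T 0) (fun _ k => T (k + r)) i
  have hκs : ∀ i, κ (i + 1) = T (κ i + r) := fun i => rfl
  have hκne : ∀ i, z (κ i + 1) ≠ z (κ i) := by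
    intro i
    cases i with
    | zero => exact hTne 0
    | succ i => exact hTne _
  have hκle : ∀ i d : ℕ, κ i + d * r ≤ κ (i + d) := by
    intro i d
    induction d with
    | zero => simp
    | succ d ih =>
      have := hTle (κ (i + d) + r)
      rw [← add_assoc, hκs]
      push_cast
      linarith
  have hκz : ∀ i d : ℕ, z (κ (i + d)) ≤ g ^ d * z (κ i) := by
    intro i d
    induction d with
    | zero => simp
    | succ d ih =>
      rw [← add_assoc, hκs, hTeq, pow_succ', mul_assoc]
      exact (hzr _).trans (mul_le_mul_right ih g)
  obtain ⟨F, hF⟩ := hN (z 0)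
  let μ : ℕ → ℤ := fun i => κ i % n
  have hμ0 : ∀ i, 0 ≤ μ i := fun i => Int.emod_nonneg _ hn0
  have hμn : ∀ i, μ i < n := fun i => Int.emod_lt_of_pos _ (by omega)
  have hμκ : ∀ i, κ i = μ i + n * (κ i / n) := fun i => (Int.emod_add_mul_ediv _ _).symm
  have hμlt : ∀ i, z (μ i) < z (μ i + 1) := by
    intro i
    refine lt_of_le_of_ne (hmono (by omega)) fun heq => hκne i ?_
    rw [hμκ i, show μ i + n * (κ i / n) + 1 = μ i + 1 + n * (κ i / n) by ring, hshift, hshift, heq]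
  have hzn0 : z n = z 0 * δ := by simpa using hzn 0
  have hFlt : ∀ i k, μ i < k → k ≤ n → F (z (μ i)) < F (z k) ∧ F (z k) ≤ N := by
    intro i k hik hk
    refine hF _ _ (hmono (hμ0 i)) ((hμlt i).trans_le (hmono (by omega))) ?_
    rw [← hzn0]
    exact hmono hk
  -- Jump residues mod `n` are separated by `F`, whose values there lie below `N`; so two of the
  -- first `N + 1` orbit points agree mod `n`.
  have hcard : (Finset.range N).card < (Finset.range (N + 1)).card := by simp
  obtain ⟨i, hi, j, hj, hij, heq⟩ := Finset.exists_ne_map_eq_of_card_lt_of_maps_to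
    (f := fun i => F (z (μ i))) hcard (fun i _ => by
      have := hFlt i n (hμn i) le_rfl
      simp only [Finset.coe_range, Set.mem_Iio]
      omega)
  wlog hlt : i < j generalizing i j
  · exact this j hj i hi hij.symm heq.symm (by omega)
  have hμeq : μ i = μ j := by
    rcases lt_trichotomy (μ i) (μ j) with hl | hl | hl
    · exact absurd heq (hFlt i _ hl (hμn j).le).1.ne
    · exact hl
    · exact absurd heq (hFlt j _ hl (hμn i).le).1.ne'
  obtain ⟨q, rfl⟩ := Nat.exists_eq_add_of_lt hlt
  have hj' := Finset.mem_range.mp hj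
  rw [add_assoc] at *
  set d := q + 1 with hd
  have hdiff : κ (i + d) = κ i + n * (κ (i + d) / n - κ i / n) := by
    linear_combination hμκ (i + d) - hμκ i - hμeq
  refine ⟨d, by omega, by omega, κ (i + d) / n - κ i / n, z (κ i), ?_, ?_⟩
  · rw [← hshift, ← hdiff]
    exact hκz i d
  · have := hκle i d
    linarith

end OrderedGroup

/-! ### The order on a Garside group. -/

section Group

variable {G : Type*} [Group G] {P : Submonoid G} {Δ : P}

lemma leL_iff {a b : G} : LeL P a b ↔ a⁻¹ * b ∈ P :=
  ⟨fun ⟨c, hc, h⟩ => by rwa [← h, inv_mul_cancel_left], fun h => ⟨_, h, mul_inv_cancel_left _ _⟩⟩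

lemma leL_refl (a : G) : LeL P a a := ⟨1, P.one_mem, mul_one a⟩

lemma LeL.trans {a b c : G} : LeL P a b → LeL P b c → LeL P a c := by
  rintro ⟨u, hu, rfl⟩ ⟨v, hv, rfl⟩
  exact ⟨u * v, P.mul_mem hu hv, (mul_assoc _ _ _).symm⟩

lemma LeL.mul_left {a b : G} (h : LeL P a b) (g : G) : LeL P (g * a) (g * b) := by
  obtain ⟨c, hc, rfl⟩ := h
  exact ⟨c, hc, mul_assoc _ _ _⟩

lemma leL_mul_left_iff {a b g : G} : LeL P (g * a) (g * b) ↔ LeL P a b :=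
  ⟨fun h => by simpa using h.mul_left g⁻¹, fun h => h.mul_left g⟩

lemma leL_coe_iff_divL {a b : P} : LeL P (a : G) b ↔ DivL a b :=
  ⟨fun ⟨c, hc, h⟩ => ⟨⟨c, hc⟩, Subtype.ext h⟩, fun ⟨c, h⟩ => ⟨c, c.2, by rw [← h]; rfl⟩⟩

namespace IsGarsideGroup


/-- For simple `b`, if `b c = Δ` and `c d = Δ`, then conjugation by `Δ` takes `b` to `d`, again
positive. Simple elements generate `P`. -/
lemma conj_mem (hG : IsGarsideGroup P Δ) {a : G} (ha : a ∈ P) :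
    (Δ : G)⁻¹ * a * Δ ∈ P ∧ (Δ : G) * a * (Δ : G)⁻¹ ∈ P := by
  have key : ∀ b : P, (Δ : G)⁻¹ * b * Δ ∈ P ∧ (Δ : G) * b * (Δ : G)⁻¹ ∈ P := by
    intro b
    have hb : b ∈ Submonoid.closure {a : P | DivL a Δ} := by
      rw [hG.monoid.closure_simple]; trivial
    induction hb using Submonoid.closure_induction with
    | mem b hb =>
      constructor
      · obtain ⟨c, hc⟩ := hb
        obtain ⟨d, hd⟩ := (hG.monoid.divL_iff_divR c).mpr ⟨b, hc⟩
        have hc' : (b : G) * c = Δ := by rw [← hc]; rfl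
        have hd' : (c : G) * d = Δ := by rw [← hd]; rfl
        have : (Δ : G)⁻¹ * b * Δ = d := by
          nth_rewrite 2 [← hd']
          rw [← hc']
          group
        rw [this]
        exact d.2
      · obtain ⟨c, hc⟩ := (hG.monoid.divL_iff_divR b).mp hb
        obtain ⟨d, hd⟩ := (hG.monoid.divL_iff_divR c).mp ⟨b, hc⟩
        have hc' : (c : G) * b = Δ := by rw [← hc]; rfl
        have hd' : (d : G) * c = Δ := by rw [← hd]; rfl
        have : (Δ : G) * b * (Δ : G)⁻¹ = d := by
          nth_rewrite 1 [← hd']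
          rw [← hc']
          group
        rw [this]
        exact d.2
    | one => simp
    | mul a b _ _ iha ihb =>
      constructor
      · convert P.mul_mem iha.1 ihb.1 using 1
        push_cast
        group
      · convert P.mul_mem iha.2 ihb.2 using 1
        push_cast
        group
  exact key ⟨a, ha⟩

lemma zpow_conj_mem (hG : IsGarsideGroup P Δ) {a : G} (ha : a ∈ P) (m : ℤ) :
    ((Δ : G) ^ m)⁻¹ * a * (Δ : G) ^ m ∈ P := by
  induction m with
  | zero => simpa
  | succ m ih =>
    convert (hG.conj_mem ih).1 using 1
    rw [zpow_add_one]
    group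
  | pred m ih =>
    convert (hG.conj_mem ih).2 using 1
    rw [zpow_sub_one]
    group

lemma leL_mul_zpow (hG : IsGarsideGroup P Δ) (m : ℤ) {a b : G} (h : LeL P a b) :
    LeL P (a * (Δ : G) ^ m) (b * (Δ : G) ^ m) := by
  rw [leL_iff] at *
  simpa [mul_assoc] using hG.zpow_conj_mem h m

lemma one_leL (Δ : P) : LeL P (1 : G) (Δ : G) := ⟨Δ, Δ.2, one_mul _⟩

lemma one_leL_zpow {m : ℤ} (hm : 0 ≤ m) : LeL P (1 : G) ((Δ : G) ^ m) := by
  obtain ⟨n, rfl⟩ := Int.eq_ofNat_of_zero_le hm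
  exact ⟨(Δ : G) ^ n, P.pow_mem Δ.2 n, by simp⟩

lemma zpow_leL_zpow {m n : ℤ} (h : m ≤ n) : LeL P ((Δ : G) ^ m) ((Δ : G) ^ n) := by
  have := (one_leL_zpow (P := P) (Δ := Δ) (sub_nonneg.mpr h)).mul_left ((Δ : G) ^ m)
  rwa [mul_one, ← zpow_add, add_sub_cancel] at this

lemma exists_leL_pow (hG : IsGarsideGroup P Δ) {a : G} (ha : a ∈ P) :
    ∃ s : ℕ, LeL P a ((Δ : G) ^ (s : ℤ)) := by
  have key : ∀ b : P, ∃ s : ℕ, LeL P (b : G) ((Δ : G) ^ (s : ℤ)) := by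
    intro b
    have hb : b ∈ Submonoid.closure {a : P | DivL a Δ} := by
      rw [hG.monoid.closure_simple]; trivial
    induction hb using Submonoid.closure_induction with
    | mem b hb => exact ⟨1, by simpa using leL_coe_iff_divL.mpr hb⟩
    | one => exact ⟨0, by simpa using leL_refl (P := P) (1 : G)⟩
    | mul a b _ _ iha ihb =>
      obtain ⟨s, hs⟩ := iha
      obtain ⟨t, ht⟩ := ihb
      refine ⟨s + t, ?_⟩
      have h1 := hG.leL_mul_zpow t hs
      rw [← zpow_add] at h1
      push_cast
      exact (ht.mul_left a).trans h1
  exact key ⟨a, ha⟩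

lemma exists_leL_zpow (hG : IsGarsideGroup P Δ) (g : G) : ∃ s : ℤ, LeL P g ((Δ : G) ^ s) := by
  obtain ⟨a, ha, b, hb, rfl⟩ := hG.fractions g
  obtain ⟨s, hs⟩ := hG.exists_leL_pow ha
  exact ⟨s, LeL.trans ⟨b, hb, by simp⟩ hs⟩

lemma inv_leL_zpow_iff (hG : IsGarsideGroup P Δ) {g : G} {s : ℤ} :
    LeL P g⁻¹ ((Δ : G) ^ (-s)) ↔ LeL P ((Δ : G) ^ s) g := by
  rw [leL_iff, leL_iff, inv_inv]
  constructor
  · intro h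
    simpa [mul_assoc] using hG.zpow_conj_mem h s
  · intro h
    simpa [mul_assoc] using hG.zpow_conj_mem h (-s)

lemma exists_zpow_leL (hG : IsGarsideGroup P Δ) (g : G) : ∃ s : ℤ, LeL P ((Δ : G) ^ s) g := by
  obtain ⟨s, hs⟩ := hG.exists_leL_zpow g⁻¹
  exact ⟨-s, hG.inv_leL_zpow_iff.mp (by rwa [neg_neg])⟩

lemma leL_antisymm (hG : IsGarsideGroup P Δ) {a b : G} (h : LeL P a b) (h' : LeL P b a) :
    a = b := by
  obtain ⟨c, hc, rfl⟩ := h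
  obtain ⟨d, hd, h⟩ := h'
  have : (⟨c, hc⟩ : P) * ⟨d, hd⟩ = 1 :=
    Subtype.ext (by simpa [mul_assoc] using h)
  have h1 : c = 1 := congrArg Subtype.val (hG.monoid.atomic.eq_one_of_mul_eq_one this)
  rw [h1, mul_one]

/-- Left translation by a power of `Δ` reduces to positive `a` and `b`. Their meet in `P` also
dominates non-positive lower bounds `d`: translate by `Δ ^ t` to make `d` positive and compare the
two meets. -/
lemma exists_glb (hG : IsGarsideGroup P Δ) (a b : G) :
    ∃ m, LeL P m a ∧ LeL P m b ∧ ∀ d, LeL P d a → LeL P d b → LeL P d m := by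
  have one_leL_iff : ∀ {u : G}, LeL P 1 u ↔ u ∈ P := by simp [leL_iff]
  have pos : ∀ a b : P, ∃ m, LeL P m (a : G) ∧ LeL P m (b : G) ∧
      ∀ d, LeL P d (a : G) → LeL P d (b : G) → LeL P d m := by
    intro a b
    obtain ⟨m, hma, hmb, hm⟩ := (hG.monoid.latticeL a b).1
    refine ⟨m, leL_coe_iff_divL.mpr hma, leL_coe_iff_divL.mpr hmb, fun d hda hdb => ?_⟩
    obtain ⟨s, hs⟩ := hG.exists_zpow_leL d
    set t : ℕ := (-s).toNat
    have hd : LeL P 1 ((Δ : G) ^ t * d) := by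
      have h1 := (zpow_leL_zpow (P := P) (Δ := Δ) (by omega : -(t : ℤ) ≤ s)).trans hs
      simpa using h1.mul_left ((Δ : G) ^ t)
    obtain ⟨m', hma', hmb', hm'⟩ := (hG.monoid.latticeL (Δ ^ t * a) (Δ ^ t * b)).1
    obtain ⟨m'', rfl⟩ := hm' (Δ ^ t) ⟨a, rfl⟩ ⟨b, rfl⟩
    rw [← leL_coe_iff_divL] at hma' hmb'
    push_cast at hma' hmb'
    rw [leL_mul_left_iff, leL_coe_iff_divL] at hma' hmb'
    have h2 := hm m'' hma' hmb'
    have h3 := hm' ⟨_, one_leL_iff.mp hd⟩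
      (leL_coe_iff_divL.mp (by push_cast; exact hda.mul_left _))
      (leL_coe_iff_divL.mp (by push_cast; exact hdb.mul_left _))
    rw [← leL_coe_iff_divL] at h3
    push_cast at h3
    rw [leL_mul_left_iff] at h3
    exact h3.trans (leL_coe_iff_divL.mpr h2)
  obtain ⟨s, hs⟩ := hG.exists_zpow_leL a
  obtain ⟨t, ht⟩ := hG.exists_zpow_leL b
  set e : G := (Δ : G) ^ min s t with he
  have ha := ((zpow_leL_zpow (P := P) (Δ := Δ) (min_le_left s t)).trans hs).mul_left e⁻¹
  have hb := ((zpow_leL_zpow (P := P) (Δ := Δ) (min_le_right s t)).trans ht).mul_left e⁻¹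
  rw [← he, inv_mul_cancel, one_leL_iff] at ha hb
  obtain ⟨m, hma, hmb, hm⟩ := pos ⟨_, ha⟩ ⟨_, hb⟩
  refine ⟨e * m, by simpa using hma.mul_left e, by simpa using hmb.mul_left e, fun d hda hdb => ?_⟩
  have := (hm _ (hda.mul_left e⁻¹) (hdb.mul_left e⁻¹)).mul_left e
  simpa using this

/-- A Garside group is a meet-semilattice under `LeL`. -/
@[reducible] noncomputable def semilatticeInf (hG : IsGarsideGroup P Δ) : SemilatticeInf G where
  le := LeL P
  le_refl := leL_refl
  le_trans _ _ _ := LeL.trans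
  le_antisymm _ _ := hG.leL_antisymm
  inf a b := (hG.exists_glb a b).choose
  inf_le_left a b := (hG.exists_glb a b).choose_spec.1
  inf_le_right a b := (hG.exists_glb a b).choose_spec.2.1
  le_inf d a b := (hG.exists_glb a b).choose_spec.2.2 d

/-- `F a` is the atom length of `x⁻¹ a`, with the irrelevant value `0` outside `x P`. -/
lemma exists_strict_bounded (hG : IsGarsideGroup P Δ) {N : ℕ} (hN : atomNorm Δ = (N : ℕ∞))
    (x : G) : ∃ F : G → ℕ, ∀ a b, LeL P x a → LeL P a b → a ≠ b → LeL P b (x * Δ) →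
      F a < F b ∧ F b ≤ N := by
  classical
  have hat := hG.monoid.atomic
  have hmono : ∀ u v : P, atomNorm u ≤ atomNorm (u * v) := by
    intro u v
    by_cases hv : v = 1
    · simp [hv]
    · exact le_self_add.trans (hat.atomNorm_add_one_le u hv)
  refine ⟨fun a => if h : x⁻¹ * a ∈ P then (atomNorm (⟨_, h⟩ : P)).toNat else 0, ?_⟩
  intro a b hxa hab hne hb
  have hxa' := leL_iff.mp hxa
  have hxb' := leL_iff.mp (hxa.trans hab)
  obtain ⟨c, hc, rfl⟩ := hab
  have hc1 : (⟨c, hc⟩ : P) ≠ 1 := fun h => hne (by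
    have : c = 1 := congrArg Subtype.val h
    rw [this, mul_one])
  obtain ⟨d, hd, hbd⟩ := hb
  have e1 : (⟨x⁻¹ * (a * c), hxb'⟩ : P) = ⟨x⁻¹ * a, hxa'⟩ * ⟨c, hc⟩ :=
    Subtype.ext (mul_assoc _ _ _).symm
  have e2 : (⟨x⁻¹ * (a * c), hxb'⟩ : P) * ⟨d, hd⟩ = Δ := Subtype.ext (by
    simp only [Submonoid.coe_mul]
    rw [mul_assoc, hbd, inv_mul_cancel_left])
  have h1 := hat.atomNorm_add_one_le ⟨x⁻¹ * a, hxa'⟩ hc1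
  have h2 := hmono ⟨x⁻¹ * (a * c), hxb'⟩ ⟨d, hd⟩
  rw [← e1] at h1
  rw [e2, hN] at h2
  simp only [hxa', hxb', dif_pos]
  obtain ⟨m, hm⟩ := ENat.ne_top_iff_exists.mp (hat.2 ⟨x⁻¹ * a, hxa'⟩).ne
  obtain ⟨k, hk⟩ := ENat.ne_top_iff_exists.mp (hat.2 ⟨x⁻¹ * (a * c), hxb'⟩).ne
  rw [← hm, ← hk] at h1
  rw [← hk] at h2
  rw [← hm, ← hk]
  have h1' : m + 1 ≤ k := by exact_mod_cast h1
  have h2' : k ≤ N := by exact_mod_cast h2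
  simpa using ⟨by omega, h2'⟩

lemma subsingleton (hG : IsGarsideGroup P Δ) (h : (Δ : G) = 1) : Subsingleton G := by
  refine ⟨fun a b => ?_⟩
  have key : ∀ g : G, g = 1 := by
    intro g
    obtain ⟨s, hs⟩ := hG.exists_leL_zpow g
    obtain ⟨t, ht⟩ := hG.exists_zpow_leL g
    rw [h, one_zpow] at hs ht
    exact hG.leL_antisymm hs ht
  rw [key a, key b]

lemma zpow_leL_zpow_iff (hG : IsGarsideGroup P Δ) (h : (Δ : G) ≠ 1) {m n : ℤ} :
    LeL P ((Δ : G) ^ m) ((Δ : G) ^ n) ↔ m ≤ n := by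
  refine ⟨fun hmn => ?_, zpow_leL_zpow⟩
  by_contra! hlt
  have h1 := (zpow_leL_zpow (P := P) (Δ := Δ) (by omega : n + 1 ≤ m)).trans hmn
  have h2 := hG.leL_antisymm h1 (zpow_leL_zpow (by omega))
  rw [zpow_add_one] at h2
  exact h (mul_eq_left.mp h2)

/-! ### Infima, summit infima and slopes. -/

lemma bddAbove_inf (hG : IsGarsideGroup P Δ) (h : (Δ : G) ≠ 1) (g : G) :
    BddAbove {r : ℤ | LeL P ((Δ : G) ^ r) g} := by
  obtain ⟨s, hs⟩ := hG.exists_leL_zpow g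
  exact ⟨s, fun r hr => (hG.zpow_leL_zpow_iff h).mp (LeL.trans hr hs)⟩

lemma le_inf_iff (hG : IsGarsideGroup P Δ) (h : (Δ : G) ≠ 1) {g : G} {r : ℤ} :
    r ≤ inf P Δ g ↔ LeL P ((Δ : G) ^ r) g :=
  ⟨fun hr => (zpow_leL_zpow hr).trans
    (Int.csSup_mem (hG.exists_zpow_leL g) (hG.bddAbove_inf h g)),
    fun hr => le_csSup (hG.bddAbove_inf h g) hr⟩

lemma zpow_leL_conj_iff {g x : G} {r : ℤ} :
    LeL P ((Δ : G) ^ r) (x⁻¹ * g * x) ↔ LeL P (x * (Δ : G) ^ r) (g * x) := by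
  rw [← leL_mul_left_iff (g := x)]
  simp [mul_assoc]

lemma pow_leL (hG : IsGarsideGroup P Δ) {g x : G} {r : ℤ} (h : LeL P (x * (Δ : G) ^ r) (g * x))
    (n : ℕ) : LeL P (x * (Δ : G) ^ (n * r)) (g ^ n * x) := by
  induction n with
  | zero => simpa using leL_refl x
  | succ n ih =>
    have h1 := hG.leL_mul_zpow r ih
    rw [mul_assoc, mul_assoc, ← zpow_add] at h1
    have h2 := h1.trans (h.mul_left (g ^ n))
    rw [← mul_assoc, ← pow_succ] at h2
    push_cast
    rwa [add_mul, one_mul]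

/-- If `g ≤ Δ ^ s`, then every conjugate has infimum at most `s`: comparing `n`-th powers, the
conjugator costs only a constant independent of `n`. -/
lemma bddAbove_inf_conjClass (hG : IsGarsideGroup P Δ) (h : (Δ : G) ≠ 1) (g : G) :
    BddAbove (inf P Δ '' conjClass g) := by
  obtain ⟨s, hs⟩ := hG.exists_leL_zpow g
  refine ⟨s, ?_⟩
  rintro _ ⟨_, ⟨x, rfl⟩, rfl⟩
  set r := inf P Δ (x⁻¹ * g * x) with hr
  have hr' := zpow_leL_conj_iff.mp ((hG.le_inf_iff h).mp hr.le)
  obtain ⟨a, ha⟩ := hG.exists_zpow_leL x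
  obtain ⟨b, hb⟩ := hG.exists_leL_zpow x
  have hgn : ∀ n : ℕ, LeL P (g ^ n) ((Δ : G) ^ (n * s)) := by
    intro n
    induction n with
    | zero => simpa using leL_refl (P := P) (1 : G)
    | succ n ih =>
      have h1 := hG.leL_mul_zpow s ih
      rw [← zpow_add] at h1
      push_cast
      rw [pow_succ, add_mul, one_mul]
      exact (hs.mul_left _).trans h1
  have key : ∀ n : ℕ, a + n * r ≤ n * s + b := by
    intro n
    rw [← hG.zpow_leL_zpow_iff h, zpow_add, zpow_add]
    exact (hG.leL_mul_zpow _ ha).trans ((hG.pow_leL hr' n).trans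
      ((hb.mul_left _).trans (hG.leL_mul_zpow _ (hgn n))))
  by_contra! hlt
  have h1 := key (b - a + 1).toNat
  have h2 := Int.self_le_toNat (b - a + 1)
  nlinarith

lemma conjClass_nonempty (g : G) : (conjClass g).Nonempty := ⟨g, 1, by simp⟩

lemma le_infS_iff (hG : IsGarsideGroup P Δ) (h : (Δ : G) ≠ 1) {g : G} {r : ℤ} :
    r ≤ infS P Δ g ↔ ∃ x, LeL P (x * (Δ : G) ^ r) (g * x) := by
  constructor
  · intro hr
    obtain ⟨_, ⟨x, rfl⟩, hx⟩ := Int.csSup_mem ((conjClass_nonempty g).image (inf P Δ))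
      (hG.bddAbove_inf_conjClass h g)
    exact ⟨x, zpow_leL_conj_iff.mp ((hG.le_inf_iff h).mp (hr.trans hx.ge))⟩
  · rintro ⟨x, hx⟩
    exact ((hG.le_inf_iff h).mpr (zpow_leL_conj_iff.mpr hx)).trans
      (le_csSup (hG.bddAbove_inf_conjClass h g) ⟨_, ⟨x, rfl⟩, rfl⟩)

lemma mul_infS_le (hG : IsGarsideGroup P Δ) (h : (Δ : G) ≠ 1) (g : G) (n : ℕ) :
    n * infS P Δ g ≤ infS P Δ (g ^ n) := by
  obtain ⟨x, hx⟩ := (hG.le_infS_iff h).mp (le_refl (infS P Δ g))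
  exact (hG.le_infS_iff h).mpr ⟨x, hG.pow_leL hx n⟩

lemma mulLeftMono (hG : IsGarsideGroup P Δ) :
    letI := hG.semilatticeInf
    MulLeftMono G :=
  letI := hG.semilatticeInf
  ⟨fun g _ _ h => LeL.mul_left h g⟩

lemma le_infS_of_mul_le (hG : IsGarsideGroup P Δ) (h : (Δ : G) ≠ 1) {g : G} {n : ℕ} (hn : 1 ≤ n)
    {r : ℤ} (hr : r * n ≤ infS P Δ (g ^ n)) : r ≤ infS P Δ g := by
  obtain ⟨x, hx⟩ := (hG.le_infS_iff h).mp hr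
  let := hG.semilatticeInf
  have := hG.mulLeftMono
  exact (hG.le_infS_iff h).mpr
    (exists_le_of_pow (one_leL Δ) (fun m _ _ h => hG.leL_mul_zpow m h) hn hx)

lemma exists_infS_pow_le (hG : IsGarsideGroup P Δ) (h : (Δ : G) ≠ 1) {N : ℕ}
    (hN : atomNorm Δ = (N : ℕ∞)) (g : G) {n : ℕ} (hn : 1 ≤ n) :
    ∃ q : ℕ, 1 ≤ q ∧ q ≤ N ∧ q * infS P Δ (g ^ n) ≤ n * infS P Δ (g ^ q) := by
  obtain ⟨x, hx⟩ := (hG.le_infS_iff h).mp (le_refl (infS P Δ (g ^ n)))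
  let := hG.semilatticeInf
  have := hG.mulLeftMono
  obtain ⟨q, hq, hqN, p, y, hy, hle⟩ := exists_bounded_pow (one_leL Δ) h
    (fun m _ _ h => hG.leL_mul_zpow m h)
    (fun x => (hG.exists_strict_bounded hN x).imp fun F hF a b hxa hab hb =>
      hF a b hxa hab.le hab.ne hb) hn hx
  have h1 : p ≤ infS P Δ (g ^ q) := (hG.le_infS_iff h).mpr ⟨y, hy⟩
  exact ⟨q, hq, hqN, hle.trans (by gcongr)⟩

lemma inf_add_le (hG : IsGarsideGroup P Δ) (h : (Δ : G) ≠ 1) (a b : G) :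
    inf P Δ a + inf P Δ b ≤ inf P Δ (a * b) := by
  have ha := hG.leL_mul_zpow (inf P Δ b) ((hG.le_inf_iff h).mp (le_refl (inf P Δ a)))
  have hb := (hG.le_inf_iff h).mp (le_refl (inf P Δ b))
  rw [hG.le_inf_iff h, zpow_add]
  exact ha.trans (hb.mul_left a)

lemma mul_inf_le (hG : IsGarsideGroup P Δ) (h : (Δ : G) ≠ 1) (g : G) (n : ℕ) :
    n * inf P Δ g ≤ inf P Δ (g ^ n) := by
  have := hG.pow_leL (x := 1) (g := g) (by simpa using (hG.le_inf_iff h).mp le_rfl) n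
  rw [hG.le_inf_iff h]
  simpa using this

lemma pow_mem_conjClass {g h : G} (hh : h ∈ conjClass g) (n : ℕ) : h ^ n ∈ conjClass (g ^ n) := by
  obtain ⟨x, rfl⟩ := hh
  exact ⟨x, by simpa using conj_pow (a := x⁻¹) (b := g) (i := n)⟩

lemma inv_mem_conjClass {g h : G} (hh : h ∈ conjClass g) : h⁻¹ ∈ conjClass g⁻¹ := by
  obtain ⟨x, rfl⟩ := hh
  exact ⟨x, by group⟩

lemma infS_of_subsingleton [Subsingleton G] (g h : G) : infS P Δ g = inf P Δ h := by
  have : conjClass g = {h} := by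
    ext k
    simp only [Subsingleton.elim k h, Set.mem_singleton_iff, iff_true]
    exact ⟨1, Subsingleton.elim _ _⟩
  rw [infS, this, Set.image_singleton, csSup_singleton]

lemma supS_of_subsingleton [Subsingleton G] (g h : G) : supS P Δ g = sup P Δ h := by
  have : conjClass g = {h} := by
    ext k
    simp only [Subsingleton.elim k h, Set.mem_singleton_iff, iff_true]
    exact ⟨1, Subsingleton.elim _ _⟩
  rw [supS, this, Set.image_singleton, csInf_singleton]

lemma inf_pow_eq_infS (hG : IsGarsideGroup P Δ) {N : ℕ} (hN : atomNorm Δ = (N : ℕ∞)) {g h : G}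
    (hh : h ∈ conjClass g)
    (hpow : ∀ n : ℕ, 1 ≤ n → n ≤ N → inf P Δ (h ^ n) = infS P Δ (g ^ n)) {n : ℕ} (hn : 1 ≤ n) :
    inf P Δ (h ^ n) = infS P Δ (g ^ n) := by
  -- If `Δ = 1` the group is trivial and each class is a singleton, so the value given to `inf` does
  -- not matter.
  by_cases hΔ : (Δ : G) = 1
  · have := hG.subsingleton hΔ
    exact (infS_of_subsingleton _ _).symm
  refine le_antisymm
    (le_csSup (hG.bddAbove_inf_conjClass hΔ _) ⟨_, pow_mem_conjClass hh n, rfl⟩) ?_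
  have hne : (Finset.Icc 1 N).Nonempty := by
    obtain ⟨q, h1, h2, -⟩ := hG.exists_infS_pow_le hΔ hN g hn
    exact ⟨q, Finset.mem_Icc.mpr ⟨h1, h2⟩⟩
  obtain ⟨q, hq, hmax⟩ := Finset.exists_max_image (Finset.Icc 1 N)
    (fun q : ℕ => (infS P Δ (g ^ q) : ℚ) / q) hne
  obtain ⟨hq1, hqN⟩ := Finset.mem_Icc.mp hq
  have hslope : (q : ℤ) * infS P Δ (g ^ n) ≤ n * infS P Δ (g ^ q) := by
    obtain ⟨m, hm1, hmN, hm⟩ := hG.exists_infS_pow_le hΔ hN g hn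
    have h1 := hmax m (Finset.mem_Icc.mpr ⟨hm1, hmN⟩)
    rw [div_le_div_iff₀ (by exact_mod_cast hm1) (by exact_mod_cast hq1)] at h1
    have h1' : infS P Δ (g ^ m) * q ≤ infS P Δ (g ^ q) * m := by exact_mod_cast h1
    have hm0 : (0 : ℤ) < m := by omega
    refine le_of_mul_le_mul_left (a := (m : ℤ)) ?_ hm0
    have h2 := mul_le_mul_of_nonneg_left hm (Int.natCast_nonneg q)
    have h3 := mul_le_mul_of_nonneg_left h1' (Int.natCast_nonneg n)
    linarith
  obtain ⟨k, s, hs, rfl⟩ : ∃ k s, s < q ∧ n = q * k + s :=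
    ⟨n / q, n % q, Nat.mod_lt _ hq1, (Nat.div_add_mod n q).symm⟩
  have hk : k * infS P Δ (g ^ q) ≤ inf P Δ (h ^ (q * k)) := by
    rw [← hpow q hq1 hqN, pow_mul]
    exact hG.mul_inf_le hΔ _ _
  push_cast at hslope
  rcases Nat.eq_zero_or_pos s with rfl | hs0
  · rw [add_zero] at *
    refine le_trans ?_ hk
    refine le_of_mul_le_mul_left (a := (q : ℤ)) ?_ (by omega)
    push_cast at hslope
    linarith
  -- By maximality of the slope at `q`, `q` times the left side is at most `s inf_s(g ^ q) ≤
  -- inf_s((g ^ s) ^ q)`; then divide by `q`.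
  · have h1 : infS P Δ (g ^ (q * k + s)) - k * infS P Δ (g ^ q) ≤ infS P Δ (g ^ s) := by
      refine hG.le_infS_of_mul_le hΔ hq1 ?_
      have h2 := hG.mul_infS_le hΔ (g ^ q) s
      rw [← pow_mul, mul_comm q s, pow_mul] at h2
      linarith
    rw [← hpow s hs0 (by omega)] at h1
    have h3 := hG.inf_add_le hΔ (h ^ (q * k)) (h ^ s)
    rw [← pow_add] at h3
    linarith

/-! ### Suprema by inversion. -/

open Pointwise in
lemma sup_eq_neg_inf_inv (hG : IsGarsideGroup P Δ) (h : (Δ : G) ≠ 1) (g : G) :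
    sup P Δ g = -inf P Δ g⁻¹ := by
  have : {s : ℤ | LeL P g ((Δ : G) ^ s)} = -{r : ℤ | LeL P ((Δ : G) ^ r) g⁻¹} := by
    ext s
    simp only [Set.mem_neg, Set.mem_ofPred_eq]
    rw [← hG.inv_leL_zpow_iff, neg_neg, inv_inv]
  have hne : {r : ℤ | LeL P ((Δ : G) ^ r) g⁻¹}.Nonempty := hG.exists_zpow_leL _
  rw [sup, inf, this, csInf_neg hne (hG.bddAbove_inf h _)]

open Pointwise in
lemma supS_eq_neg_infS_inv (hG : IsGarsideGroup P Δ) (h : (Δ : G) ≠ 1) (g : G) :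
    supS P Δ g = -infS P Δ g⁻¹ := by
  have : sup P Δ '' conjClass g = -(inf P Δ '' conjClass g⁻¹) := by
    ext s
    simp only [Set.mem_neg, Set.mem_image]
    constructor
    · rintro ⟨k, hk, rfl⟩
      exact ⟨k⁻¹, inv_mem_conjClass hk, by rw [hG.sup_eq_neg_inf_inv h, neg_neg]⟩
    · rintro ⟨k, hk, hs⟩
      refine ⟨k⁻¹, by simpa using inv_mem_conjClass hk, ?_⟩
      rw [hG.sup_eq_neg_inf_inv h, inv_inv, hs, neg_neg]
  rw [supS, infS, this, csInf_neg ((conjClass_nonempty _).image _) (hG.bddAbove_inf_conjClass h _)]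

lemma sup_pow_eq_supS (hG : IsGarsideGroup P Δ) {N : ℕ} (hN : atomNorm Δ = (N : ℕ∞)) {g h : G}
    (hh : h ∈ conjClass g)
    (hpow : ∀ n : ℕ, 1 ≤ n → n ≤ N → sup P Δ (h ^ n) = supS P Δ (g ^ n)) {n : ℕ} (hn : 1 ≤ n) :
    sup P Δ (h ^ n) = supS P Δ (g ^ n) := by
  by_cases hΔ : (Δ : G) = 1
  · have := hG.subsingleton hΔ
    exact (supS_of_subsingleton _ _).symm
  simp only [hG.sup_eq_neg_inf_inv hΔ, hG.supS_eq_neg_infS_inv hΔ, neg_inj, ← inv_pow] at hpow ⊢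
  exact hG.inf_pow_eq_infS hN (inv_mem_conjClass hh) hpow hn

end IsGarsideGroup

end Group

end Garside

theorem theorem6p1 {G : Type*} [Group G] (P : Submonoid G) (Δ : P)
    (hG : Garside.IsGarsideGroup P Δ) (N : ℕ) (hN : Garside.atomNorm Δ = (N : ℕ∞)) (g : G) :
    (∀ h ∈ Garside.conjClass g,
      (∀ n : ℕ, 1 ≤ n → n ≤ N → Garside.inf P Δ (h ^ n) = Garside.infS P Δ (g ^ n)) →
      ∀ n : ℕ, 1 ≤ n → Garside.inf P Δ (h ^ n) = Garside.infS P Δ (g ^ n)) ∧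
    (∀ h ∈ Garside.conjClass g,
      (∀ n : ℕ, 1 ≤ n → n ≤ N → Garside.sup P Δ (h ^ n) = Garside.supS P Δ (g ^ n)) →
      ∀ n : ℕ, 1 ≤ n → Garside.sup P Δ (h ^ n) = Garside.supS P Δ (g ^ n)) ∧
    Garside.stableSuperSummitSet P Δ g =
      {h ∈ Garside.superSummitSet P Δ g |
        ∀ n : ℕ, 1 ≤ n → n ≤ N → h ^ n ∈ Garside.superSummitSet P Δ (g ^ n)} := by
  refine ⟨fun h hh hpow n hn => hG.inf_pow_eq_infS hN hh hpow hn,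
    fun h hh hpow n hn => hG.sup_pow_eq_supS hN hh hpow hn, Set.ext fun h => ?_⟩
  refine ⟨fun hst => ⟨hst.1, fun n hn _ => hst.2 n hn⟩, fun ⟨hS, hpow⟩ => ⟨hS, fun n hn => ?_⟩⟩
  exact ⟨Garside.IsGarsideGroup.pow_mem_conjClass hS.1 n,
    hG.inf_pow_eq_infS hN hS.1 (fun m h1 h2 => (hpow m h1 h2).2.1) hn,
    hG.sup_pow_eq_supS hN hS.1 (fun m h1 h2 => (hpow m h1 h2).2.2) hn⟩
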